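/- Let $p$ be a prime number and let $R$ be a regular (in particular noetherian) commutative ring of characteristic $p$ that is $F$-finite, i.e. the Frobenius endomorphism $F\colon R\to R$, $a\mapsto a^p$, is a finite ring homomorphism. For an $R$-module $M$ put $F^{\flat}M=\operatorname{Hom}_R(F_*R,M)$, with the $R$-module structure given by pre-multiplication on $F_*R$; here $F_*R$ is $R$ regarded as an $R$-module by restriction of scalars along $F$. A Cartier module over $R$ is a pair $(M,\kappa_M)$ of an $R$-module $M$ and an $R$-linear map $\kappa_M\colon M\to F^{\flat}M$ (equivalently, an $R$-linear map $F_*M\to M$, or a right module structure over the twisted polynomial ring $R[F]=R\{F\}/\langle a^pF-Fa\mid a\in R\rangle$); morphisms are the $R$-linear maps that commute with the structure maps. Let $\operatorname{Cart}_R$ denote the category of Cartier modules and $\operatorname{Cart}^{\operatorname{unit}}_R$ its full subcategory of unit Cartier modules, i.e. those $(M,\kappa_M)$ for which $\kappa_M$ is an isomorphism; both categories are abelian. Then for every unit Cartier module $M$ over $R$, \[ \operatorname{inj.dim}_{\operatorname{Cart}^{\operatorname{unit}}_R}(M)=\operatorname{inj.dim}_{\operatorname{Cart}_R}(M), \] where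 either side may be infinite. -/

import Mathlib

open CategoryTheory CategoryTheory.Limits
universe v u

namespace CategoryTheory.Endofunctor.Coalgebra

variable {C : Type u} [Category.{v} C] (G : C ⥤ C)

/-- The structure morphisms of coalgebras, as a natural transformation. -/
@[simps] def strNat : forget G ⟶ forget G ⋙ G where
  app M := M.str
  naturality _ _ f := f.h.symm

section Limits

variable {G} {J : Type} [SmallCategory J] (K : J ⥤ Coalgebra G)

/-- The colimit of a diagram of coalgebras, on a colimit of the underlying objects. -/
@[simps] def colimitCocone (c : Cocone (K ⋙ forget G)) (hc : IsColimit c) : Cocone K where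
  pt :=
    { V := c.pt
      str := hc.desc ((Cocone.precompose (Functor.whiskerLeft K (strNat G))).obj (G.mapCocone c)) }
  ι :=
    { app := fun j =>
        { f := c.ι.app j
          h := (hc.fac ((Cocone.precompose
            (Functor.whiskerLeft K (strNat G))).obj (G.mapCocone c)) j).symm }
      naturality := fun i j f => by
        ext
        exact c.ι.naturality f }

/-- The cocone `colimitCocone` is a colimit. -/
def isColimitColimitCocone (c : Cocone (K ⋙ forget G)) (hc : IsColimit c) :
    IsColimit (colimitCocone K c hc) where
  desc s :=
    { f := hc.desc ((forget G).mapCocone s)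
      h := hc.hom_ext fun j => by
        have h : (strNat G).app (K.obj j) ≫ G.map ((forget G).map (s.ι.app j)) =
          (forget G).map (s.ι.app j) ≫ (strNat G).app s.pt := (s.ι.app j).h
        have h2 := hc.fac ((forget G).mapCocone s) j
        refine (hc.fac_assoc _ j _).trans (Eq.trans ?_ (hc.fac_assoc _ j _).symm)
        refine Eq.trans ?_ h
        refine (Category.assoc _ _ _).trans (congrArg (fun t => (strNat G).app (K.obj j) ≫ t) ?_)
        exact (G.map_comp _ _).symm.trans (congrArg (fun t => G.map t) h2) }
  fac s j := by
    ext
    exact hc.fac _ j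
  uniq s m h := by
    ext
    exact hc.hom_ext fun j =>
      (congrArg Hom.f (h j)).trans (hc.fac ((forget G).mapCocone s) j).symm

noncomputable instance : CreatesColimitsOfShape J (forget G) where
  CreatesColimit {K} := createsColimitOfReflectsIso fun c hc =>
    { liftedCocone := colimitCocone K c hc
      validLift := Cocone.ext (Iso.refl _) fun _ => Category.comp_id _
      makesColimit := isColimitColimitCocone K c hc }

variable [PreservesLimitsOfShape J G]

/-- The limit of a diagram of coalgebras, on a limit of the underlying objects
that is preserved by the endofunctor. -/
@[simps] noncomputable def limitCone (c : Cone (K ⋙ forget G)) (hc : IsLimit c) : Cone K where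
  pt :=
    { V := c.pt
      str := (isLimitOfPreserves G hc).lift
        ((Cone.postcompose (Functor.whiskerLeft K (strNat G))).obj c) }
  π :=
    { app := fun j =>
        { f := c.π.app j
          h := (isLimitOfPreserves G hc).fac
            ((Cone.postcompose (Functor.whiskerLeft K (strNat G))).obj c) j }
      naturality := fun i j f => by
        ext
        exact c.π.naturality f }

/-- The cone `limitCone` is a limit. -/
noncomputable def isLimitLimitCone (c : Cone (K ⋙ forget G)) (hc : IsLimit c) :
    IsLimit (limitCone K c hc) where
  lift s :=
    { f := hc.lift ((forget G).mapCone s)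
      h := (isLimitOfPreserves G hc).hom_ext fun j => by
        have h : (strNat G).app s.pt ≫ G.map ((forget G).map (s.π.app j)) =
          (forget G).map (s.π.app j) ≫ (strNat G).app (K.obj j) := (s.π.app j).h
        have h1 := (isLimitOfPreserves G hc).fac
            ((Cone.postcompose (Functor.whiskerLeft K (strNat G))).obj c) j
        have h2 := hc.fac ((forget G).mapCone s) j
        refine (Category.assoc _ _ _).trans (Eq.trans ?_ (Category.assoc _ _ _).symm)
        refine Eq.trans ?_ (congrArg (fun t => hc.lift ((forget G).mapCone s) ≫ t) h1).symm
        refine Eq.trans ?_ (hc.fac_assoc ((forget G).mapCone s) j ((strNat G).app (K.obj j))).symm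
        refine Eq.trans ?_ h
        refine congrArg (fun t => (strNat G).app s.pt ≫ t) ?_
        exact (G.map_comp _ _).symm.trans (congrArg (fun t => G.map t) h2) }
  fac s j := by
    ext
    exact hc.fac _ j
  uniq s m h := by
    ext
    exact hc.hom_ext fun j =>
      (congrArg Hom.f (h j)).trans (hc.fac ((forget G).mapCone s) j).symm

noncomputable instance : CreatesLimitsOfShape J (forget G) where
  CreatesLimit {K} := createsLimitOfReflectsIso fun c hc =>
    { liftedCone := limitCone K c hc
      validLift := Cone.ext (Iso.refl _) fun _ => (Category.id_comp _).symm
      makesLimit := isLimitLimitCone K c hc }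

end Limits

section Abelian

variable [Abelian C] [G.Additive] [PreservesFiniteLimits G]

instance : HasFiniteLimits (Coalgebra G) :=
  ⟨fun _ _ _ => hasLimitsOfShape_of_hasLimitsOfShape_createsLimitsOfShape (forget G)⟩

instance : HasFiniteColimits (Coalgebra G) :=
  ⟨fun _ _ _ => hasColimitsOfShape_of_hasColimitsOfShape_createsColimitsOfShape (forget G)⟩

instance : PreservesFiniteLimits (forget G) := ⟨fun _ _ _ => inferInstance⟩

instance : PreservesFiniteColimits (forget G) := ⟨fun _ _ _ => inferInstance⟩

/-- Coalgebras of a left exact endofunctor of an abelian category form an abelian category. -/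
noncomputable instance : Abelian (Coalgebra G) :=
  have : ∀ {X Y : Coalgebra G} (f : X ⟶ Y), IsIso (Abelian.coimageImageComparison f) := fun f => by
    have : IsIso ((forget G).map (Abelian.coimageImageComparison f)) := by
      rw [Arrow.isIso_iff_isIso_of_isIso
        (Abelian.PreservesCoimageImageComparison.iso (forget G) f).hom]
      infer_instance
    exact isIso_of_reflects_iso _ (forget G)
  have : HasFiniteProducts (Coalgebra G) := hasFiniteProducts_of_hasFiniteLimits _
  Abelian.ofCoimageImageComparisonIsIso

end Abelian

section Unit

/-- A coalgebra is unit if its structure morphism is an isomorphism. -/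
def isUnit : ObjectProperty (Coalgebra G) := fun M => IsIso M.str

/-- The endofunctor of the category of coalgebras induced by the endofunctor `G`. -/
@[simps] def lift : Coalgebra G ⥤ Coalgebra G where
  obj M := { V := G.obj M.V, str := G.map M.str }
  map f :=
    { f := G.map f.f
      h := by rw [← G.map_comp, ← G.map_comp, f.h] }

/-- The structure morphisms of coalgebras, as morphisms of coalgebras. -/
@[simps] def toLift : 𝟭 (Coalgebra G) ⟶ lift G where
  app M := { f := M.str }
  naturality _ _ f := by
    ext
    exact f.h.symm

lemma lift_map_toLift (M : Coalgebra G) :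
    (lift G).map ((toLift G).app M) = (toLift G).app ((lift G).obj M) := rfl

variable {G} in
lemma isIso_toLift_app {M : Coalgebra G} (hM : isUnit G M) : IsIso ((toLift G).app M) :=
  have : IsIso ((toLift G).app M).f := hM
  iso_of_iso _

/-- The iterates of `lift G`. -/
def iter : ℕ → (Coalgebra G ⥤ Coalgebra G)
  | 0 => 𝟭 _
  | n + 1 => iter n ⋙ lift G

/-- The transition morphisms between the iterates of `lift G`. -/
def iterTrans (n : ℕ) : iter G n ⟶ iter G (n + 1) := Functor.whiskerLeft (iter G n) (toLift G)

/-- The sequence of functors that sends a coalgebra `M` to `M ⟶ G M ⟶ G (G M) ⟶ ...`. -/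
def iterSeq : ℕ ⥤ (Coalgebra G ⥤ Coalgebra G) := Functor.ofSequence (iterTrans G)

variable [HasColimitsOfShape ℕ C]

instance : HasColimitsOfShape ℕ (Coalgebra G) :=
  hasColimitsOfShape_of_hasColimitsOfShape_createsColimitsOfShape (forget G)

/-- The unitalization `colim (M ⟶ G M ⟶ G (G M) ⟶ ...)` of a coalgebra `M`. -/
noncomputable def unitalization : Coalgebra G ⥤ Coalgebra G := colimit (iterSeq G)

/-- The canonical morphisms to the unitalization. -/
noncomputable def unitalizationι (n : ℕ) : iter G n ⟶ unitalization G := colimit.ι (iterSeq G) n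

lemma iterTrans_ι (n : ℕ) :
    iterTrans G n ≫ unitalizationι G (n + 1) = unitalizationι G n := by
  have h := colimit.w (iterSeq G) (homOfLE (Nat.le_add_right n 1))
  rwa [iterSeq, Functor.ofSequence_map_homOfLE_succ] at h

lemma toLift_ι (n : ℕ) (M : Coalgebra G) :
    (toLift G).app ((iter G n).obj M) ≫ (unitalizationι G (n + 1)).app M =
      (unitalizationι G n).app M :=
  congrArg (fun t => t.app M) (iterTrans_ι G n)

/-- The value of the unitalization on a coalgebra is a colimit. -/
noncomputable def isColimitUnitalization (M : Coalgebra G) :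
    IsColimit (((evaluation _ _).obj M).mapCocone (colimit.cocone (iterSeq G))) :=
  isColimitOfPreserves _ (colimit.isColimit (iterSeq G))

variable {G} in
lemma unitalization_hom_ext {M N : Coalgebra G} {f g : (unitalization G).obj M ⟶ N}
    (h : ∀ n, (unitalizationι G n).app M ≫ f = (unitalizationι G n).app M ≫ g) : f = g :=
  (isColimitUnitalization G M).hom_ext h

variable {G} in
/-- A cocone on the sequence defining the unitalization. -/
def seqCocone {M N : Coalgebra G} (φ : ∀ n, (iter G n).obj M ⟶ N)
    (hφ : ∀ n, (toLift G).app ((iter G n).obj M) ≫ φ (n + 1) = φ n) :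
    Cocone (iterSeq G ⋙ (evaluation _ _).obj M) where
  pt := N
  ι := NatTrans.ofSequence φ fun n => by
    have h := congrArg (fun t => t.app M) (Functor.ofSequence_map_homOfLE_succ (iterTrans G) n)
    refine (congrArg (fun t => t ≫ φ (n + 1)) h).trans ((hφ n).trans (Category.comp_id _).symm)

variable {G} in
lemma exists_unitalization_desc {M N : Coalgebra G} (φ : ∀ n, (iter G n).obj M ⟶ N)
    (hφ : ∀ n, (toLift G).app ((iter G n).obj M) ≫ φ (n + 1) = φ n) :
    ∃ f : (unitalization G).obj M ⟶ N, ∀ n, (unitalizationι G n).app M ≫ f = φ n :=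
  ⟨(isColimitUnitalization G M).desc (seqCocone φ hφ),
    fun n => (isColimitUnitalization G M).fac (seqCocone φ hφ) n⟩

variable {G} in
lemma bijective_unitalizationι_comp (M : Coalgebra G) {N : Coalgebra G} (hN : isUnit G N) :
    Function.Bijective fun f : (unitalization G).obj M ⟶ N => (unitalizationι G 0).app M ≫ f := by
  have := isIso_toLift_app hN
  have key : ∀ (n : ℕ) (f : (unitalization G).obj M ⟶ N),
      (unitalizationι G (n + 1)).app M ≫ f ≫ (toLift G).app N =
        (lift G).map ((unitalizationι G n).app M ≫ f) := fun n f => by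
    have h := (toLift G).naturality ((unitalizationι G (n + 1)).app M ≫ f)
    rw [← Category.assoc]
    refine h.trans ?_
    exact ((lift G).map_comp ((toLift G).app ((iter G n).obj M)) _).symm.trans
      (congrArg (fun t => (lift G).map t) ((Category.assoc _ _ _).symm.trans (congrArg (fun t => t ≫ f) (toLift_ι G n M))))
  constructor
  · intro f g hfg
    refine unitalization_hom_ext fun n => ?_
    induction n with
    | zero => exact hfg
    | succ n ih =>
      rw [← cancel_mono ((toLift G).app N), Category.assoc, Category.assoc, key, key, ih]
  · intro g
    let φ : ∀ n, (iter G n).obj M ⟶ N :=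
      fun n => Nat.rec g (fun n φ => (lift G).map φ ≫ inv ((toLift G).app N)) n
    obtain ⟨f, hf⟩ := exists_unitalization_desc φ fun n => by
      have h := (toLift G).naturality (φ n)
      change (toLift G).app ((iter G n).obj M) ≫ (lift G).map (φ n) ≫ inv ((toLift G).app N) = φ n
      rw [← Category.assoc, IsIso.comp_inv_eq]
      exact h.symm
    exact ⟨f, hf 0⟩

variable [PreservesColimitsOfShape ℕ G]

instance : PreservesColimitsOfShape ℕ (lift G) :=
  have : PreservesColimitsOfShape ℕ (lift G ⋙ forget G) :=
    inferInstanceAs (PreservesColimitsOfShape ℕ (forget G ⋙ G))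
  preservesColimitsOfShape_of_reflects_of_preserves (lift G) (forget G)

lemma isUnit_unitalization (M : Coalgebra G) : isUnit G ((unitalization G).obj M) := by
  have hc := isColimitOfPreserves (lift G) (isColimitUnitalization G M)
  let c : Cocone ((iterSeq G ⋙ (evaluation _ _).obj M) ⋙ lift G) :=
    { pt := (unitalization G).obj M
      ι := NatTrans.ofSequence (fun n => (unitalizationι G (n + 1)).app M) fun n => by
        have h := congrArg (fun t => (lift G).map (t.app M))
          (Functor.ofSequence_map_homOfLE_succ (iterTrans G) n)
        refine (congrArg (fun t => t ≫ (unitalizationι G (n + 2)).app M) h).trans ?_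
        exact (toLift_ι G (n + 1) M).trans (Category.comp_id _).symm }
  let g : (lift G).obj ((unitalization G).obj M) ⟶ (unitalization G).obj M := hc.desc c
  have hg : ∀ n, (lift G).map ((unitalizationι G n).app M) ≫ g = (unitalizationι G (n + 1)).app M :=
    fun n => hc.fac c n
  have nat : ∀ n, (unitalizationι G n).app M ≫ (toLift G).app ((unitalization G).obj M) =
      (toLift G).app ((iter G n).obj M) ≫ (lift G).map ((unitalizationι G n).app M) :=
    fun n => (toLift G).naturality _
  have h1 : (toLift G).app ((unitalization G).obj M) ≫ g = 𝟙 _ :=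
    unitalization_hom_ext fun n => by
      refine (Category.assoc _ _ _).symm.trans ?_
      rw [nat, Category.assoc, hg, toLift_ι]
      exact (Category.comp_id _).symm
  have h2 : g ≫ (toLift G).app ((unitalization G).obj M) = 𝟙 _ := hc.hom_ext fun n => by
    change (lift G).map ((unitalizationι G n).app M) ≫ _ =
      (lift G).map ((unitalizationι G n).app M) ≫ _
    rw [← Category.assoc, hg]
    refine (nat (n + 1)).trans (Eq.trans ?_ (Category.comp_id _).symm)
    exact ((lift G).map_comp ((toLift G).app ((iter G n).obj M)) _).symm.trans
      (congrArg (fun t => (lift G).map t) (toLift_ι G n M))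
  have : IsIso ((toLift G).app ((unitalization G).obj M)) := ⟨g, h1, h2⟩
  exact inferInstanceAs (IsIso ((forget G).map ((toLift G).app ((unitalization G).obj M))))

/-- The unitalization, as a functor to the category of unit coalgebras. -/
noncomputable def toUnit : Coalgebra G ⥤ (isUnit G).FullSubcategory :=
  (isUnit G).lift (unitalization G) (isUnit_unitalization G)

/-- The bijection on morphisms of the adjunction between unitalization and inclusion. -/
noncomputable def toUnitHomEquiv (M : Coalgebra G) (N : (isUnit G).FullSubcategory) :
    ((toUnit G).obj M ⟶ N) ≃ (M ⟶ (isUnit G).ι.obj N) :=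
  (isUnit G).fullyFaithfulι.homEquiv.trans
    (Equiv.ofBijective _ (bijective_unitalizationι_comp M N.property))

lemma toUnitHomEquiv_apply (M : Coalgebra G) (N : (isUnit G).FullSubcategory)
    (f : (toUnit G).obj M ⟶ N) :
    toUnitHomEquiv G M N f = (unitalizationι G 0).app M ≫ (isUnit G).ι.map f := rfl

/-- The unitalization is left adjoint to the inclusion. -/
noncomputable def toUnitAdj : toUnit G ⊣ (isUnit G).ι :=
  Adjunction.mkOfHomEquiv
    { homEquiv := toUnitHomEquiv G
      homEquiv_naturality_left_symm := fun {M M' N} f g => by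
        obtain ⟨x, rfl⟩ := (toUnitHomEquiv G M' N).surjective g
        rw [Equiv.symm_apply_eq, Equiv.symm_apply_apply, toUnitHomEquiv_apply,
          toUnitHomEquiv_apply, Functor.map_comp]
        exact (Category.assoc _ _ _).symm.trans ((congrArg (fun t => t ≫ (isUnit G).ι.map x)
          ((unitalizationι G 0).naturality f)).trans (Category.assoc _ _ _))
      homEquiv_naturality_right := fun {M N N'} f g => by
        rw [toUnitHomEquiv_apply, toUnitHomEquiv_apply, Functor.map_comp]
        exact (Category.assoc _ _ _).symm }

section Abelian

variable [Abelian C] [G.Additive] [PreservesFiniteLimits G] [HasExactColimitsOfShape ℕ C]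

instance : HasExactColimitsOfShape ℕ (Coalgebra G) :=
  HasExactColimitsOfShape.domain_of_functor ℕ (forget G)

instance : PreservesFiniteLimits (lift G) :=
  have : PreservesFiniteLimits (lift G ⋙ forget G) :=
    inferInstanceAs (PreservesFiniteLimits (forget G ⋙ G))
  preservesFiniteLimits_of_reflects_of_preserves (lift G) (forget G)

instance (n : ℕ) : PreservesFiniteLimits (iter G n) := by
  induction n with
  | zero => exact inferInstanceAs (PreservesFiniteLimits (𝟭 _))
  | succ n ih => exact inferInstanceAs (PreservesFiniteLimits (iter G n ⋙ lift G))

instance : PreservesFiniteLimits (unitalization G) := by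
  have : PreservesFiniteLimits (iterSeq G).flip := ⟨fun J _ _ =>
    preservesLimitsOfShape_of_evaluation _ _ fun n =>
      inferInstanceAs (PreservesLimitsOfShape J (iter G n))⟩
  exact preservesFiniteLimits_of_natIso (colimitIsoFlipCompColim (iterSeq G)).symm

instance : PreservesFiniteLimits (toUnit G) :=
  have : PreservesFiniteLimits (toUnit G ⋙ (isUnit G).ι) :=
    inferInstanceAs (PreservesFiniteLimits (unitalization G))
  preservesFiniteLimits_of_reflects_of_preserves (toUnit G) (isUnit G).ι

/-- Unit coalgebras form an abelian category. -/
noncomputable instance : Abelian (isUnit G).FullSubcategory :=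
  have : Reflective (isUnit G).ι := { L := toUnit G, adj := toUnitAdj G }
  have : HasFiniteProducts (isUnit G).FullSubcategory :=
    ⟨fun _ => hasLimitsOfShape_of_reflective (isUnit G).ι⟩
  have : (toUnit G).IsLeftAdjoint := (toUnitAdj G).isLeftAdjoint
  abelianOfAdjunction (isUnit G).ι (toUnit G) (asIso (toUnitAdj G).counit) (toUnitAdj G)

end Abelian

end Unit

end CategoryTheory.Endofunctor.Coalgebra

instance (R : Type u) [Ring R] : PreservesColimitsOfShape ℕ (forget (ModuleCat.{u} R)) :=
  have : PreservesFilteredColimitsOfSize.{0, 0} (forget (ModuleCat.{u} R)) :=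
    preservesSmallestFilteredColimits_of_preservesFilteredColimits _
  PreservesFilteredColimitsOfSize.preserves_filtered_colimits ℕ

instance (R : Type u) [Ring R] : HasExactColimitsOfShape ℕ (ModuleCat.{u} R) :=
  have : AB5OfSize.{0, 0} (ModuleCat.{u} R) := AB5OfSize_of_univLE.{0, 0, u, u} (ModuleCat.{u} R)
  AB5OfSize.ofShape ℕ

section Coextension

variable {R : Type u} [CommRing R] {K : ℕ ⥤ ModuleCat.{u} R} {c : Cocone K}

lemma exists_lift_of_isColimit (hc : IsColimit c) {ι : Type*} [Finite ι] (x : ι → c.pt) :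
    ∃ (n : ℕ) (y : ι → K.obj n), ∀ i, c.ι.app n (y i) = x i := by
  choose j y hy using fun i => Concrete.isColimit_exists_rep K hc (x i)
  obtain ⟨n, hn⟩ := (Set.finite_range j).bddAbove
  refine ⟨n, fun i => K.map (homOfLE (hn ⟨i, rfl⟩)) (y i), fun i => ?_⟩
  rw [← hy i, ← c.w (homOfLE (hn ⟨i, rfl⟩))]
  rfl

lemma exists_map_eq_zero_of_isColimit (hc : IsColimit c) {ι : Type*} [Finite ι] {m : ℕ} (y : ι → K.obj m)
    (hy : ∀ i, c.ι.app m (y i) = 0) :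
    ∃ (n : ℕ) (h : m ⟶ n), ∀ i, K.map h (y i) = 0 := by
  choose j f g hj using fun i => Concrete.isColimit_exists_of_rep_eq K hc (y i) (0 : K.obj m)
    ((hy i).trans (map_zero _).symm)
  obtain ⟨n, hn⟩ := ((Set.finite_range j).union (Set.finite_singleton m)).bddAbove
  refine ⟨n, homOfLE (hn (Or.inr rfl)), fun i => ?_⟩
  have h : j i ⟶ n := homOfLE (hn (Or.inl ⟨i, rfl⟩))
  have e : homOfLE (hn (Or.inr rfl)) = f i ≫ h := Subsingleton.elim _ _
  rw [e, K.map_comp, ModuleCat.comp_apply, hj, map_zero, map_zero]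

/-- Morphisms from a finitely presented module commute with sequential colimits. -/
lemma exists_hom_lift_of_isColimit (hc : IsColimit c)
    (P : Type u) [AddCommGroup P] [Module R P]
    [Module.FinitePresentation R P] (φ : P →ₗ[R] c.pt) :
    ∃ (n : ℕ) (ψ : P →ₗ[R] K.obj n), (c.ι.app n).hom ∘ₗ ψ = φ := by
  obtain ⟨m, π, hπ⟩ := Module.Finite.exists_fin' R P
  have hker : (LinearMap.ker π).FG := Module.FinitePresentation.fg_ker π hπ
  obtain ⟨j, y, hy⟩ := exists_lift_of_isColimit hc fun i => φ (π (Pi.basisFun R (Fin m) i))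
  let α : (Fin m → R) →ₗ[R] K.obj j := (Pi.basisFun R (Fin m)).constr ℕ y
  have hα : (c.ι.app j).hom ∘ₗ α = φ ∘ₗ π := (Pi.basisFun R (Fin m)).ext fun i => by
    rw [LinearMap.comp_apply, Module.Basis.constr_basis]
    exact hy i
  obtain ⟨T, hT⟩ := hker
  obtain ⟨n, h, hn⟩ := exists_map_eq_zero_of_isColimit hc (fun t : T => α t) fun t => by
    have ht : (t : Fin m → R) ∈ LinearMap.ker π := hT ▸ Submodule.subset_span t.2
    have h1 : (c.ι.app j).hom (α t) = φ (π t) := LinearMap.congr_fun hα t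
    rw [LinearMap.mem_ker.1 ht, map_zero] at h1
    exact h1
  have hle : LinearMap.ker π ≤ LinearMap.ker ((K.map h).hom ∘ₗ α) := by
    rw [← hT, Submodule.span_le]
    exact fun t ht => hn ⟨t, ht⟩
  obtain ⟨ψ, hψ⟩ : ∃ ψ : P →ₗ[R] K.obj n, ψ ∘ₗ π = (K.map h).hom ∘ₗ α := by
    refine ⟨(LinearMap.ker π).liftQ _ hle ∘ₗ
      (π.quotKerEquivOfSurjective hπ).symm.toLinearMap, LinearMap.ext fun x => ?_⟩
    have hx : (π.quotKerEquivOfSurjective hπ).symm (π x) = (LinearMap.ker π).mkQ x := by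
      rw [LinearEquiv.symm_apply_eq]
      rfl
    simp only [LinearMap.comp_apply, LinearEquiv.coe_coe, hx]
    rfl
  refine ⟨n, ψ, LinearMap.ext fun p => ?_⟩
  obtain ⟨x, rfl⟩ := hπ p
  have h1 : ψ (π x) = K.map h (α x) := LinearMap.congr_fun hψ x
  have h2 : (c.ι.app j).hom (α x) = φ (π x) := LinearMap.congr_fun hα x
  rw [LinearMap.comp_apply, h1, ← h2, ← c.w h]
  rfl

lemma exists_hom_eq_of_isColimit (hc : IsColimit c)
    (P : Type u) [AddCommGroup P] [Module R P]
    [Module.Finite R P] {m : ℕ} (φ ψ : P →ₗ[R] K.obj m)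
    (h : (c.ι.app m).hom ∘ₗ φ = (c.ι.app m).hom ∘ₗ ψ) :
    ∃ (n : ℕ) (f : m ⟶ n), (K.map f).hom ∘ₗ φ = (K.map f).hom ∘ₗ ψ := by
  obtain ⟨k, π, hπ⟩ := Module.Finite.exists_fin' R P
  let b := Pi.basisFun R (Fin k)
  obtain ⟨n, f, hn⟩ := exists_map_eq_zero_of_isColimit hc
    (fun i => φ (π (b i)) - ψ (π (b i))) fun i => by
      have := LinearMap.congr_fun h (π (b i))
      rw [map_sub, sub_eq_zero]
      exact this
  refine ⟨n, f, ?_⟩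
  rw [← LinearMap.cancel_right hπ]
  refine b.ext fun i => ?_
  have := hn i
  rw [map_sub, sub_eq_zero] at this
  exact this

end Coextension

/-- Coextension of scalars along a finite homomorphism from a noetherian ring commutes with
sequential colimits. -/
lemma preservesColimitsOfShape_nat_coextendScalars
    {R S : Type u} [CommRing R] [IsNoetherianRing R] [CommRing S] (f : R →+* S) (hf : f.Finite) :
    PreservesColimitsOfShape ℕ (ModuleCat.coextendScalars.{u, u, u} f) where
  preservesColimit {K} := by
    have : PreservesColimit K
        (ModuleCat.coextendScalars.{u, u, u} f ⋙ forget (ModuleCat.{u} S)) := by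
      have : Module.FinitePresentation R ((ModuleCat.restrictScalars f).obj (ModuleCat.of S S)) := by
        algebraize [f]
        exact Module.finitePresentation_of_finite R S
      refine ⟨fun {c} hc => ⟨Types.FilteredColimit.isColimitOf' _ _
        (fun φ => ?_) fun m φ ψ h => ?_⟩⟩
      · obtain ⟨n, ψ, hψ⟩ := exists_hom_lift_of_isColimit hc
          ((ModuleCat.restrictScalars f).obj (ModuleCat.of S S))
          (ModuleCat.CoextendScalars.equiv f c.pt φ)
        exact ⟨n, (ModuleCat.CoextendScalars.equiv f (K.obj n)).symm ψ, hψ.symm⟩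
      · exact exists_hom_eq_of_isColimit hc
          ((ModuleCat.restrictScalars f).obj (ModuleCat.of S S))
          (ModuleCat.CoextendScalars.equiv f (K.obj m) φ)
          (ModuleCat.CoextendScalars.equiv f (K.obj m) ψ) h
    have : ReflectsColimit (K ⋙ ModuleCat.coextendScalars.{u, u, u} f)
        (forget (ModuleCat.{u} S)) :=
      reflectsColimit_of_reflectsIsomorphisms _ _
    exact preservesColimit_of_reflects_of_preserves (ModuleCat.coextendScalars.{u, u, u} f)
      (forget (ModuleCat.{u} S))

section CartierModules

variable (R : Type u) [CommRing R] (p : ℕ) [Fact p.Prime] [CharP R p]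

/-- A ring of prime characteristic `p` is `F`-finite if its Frobenius endomorphism is finite. -/
class IsFFinite : Prop where
  finite_frobenius : (frobenius R p).Finite

/-- The functor `F^♭ = Hom_R(F_* R, -)` on `R`-modules, right adjoint to the restriction of scalars
`F_*` along the Frobenius endomorphism `F` of `R`. -/
noncomputable abbrev frobeniusFlat : ModuleCat.{u} R ⥤ ModuleCat.{u} R :=
  ModuleCat.coextendScalars.{u, u, u} (frobenius R p)

/-- The category of Cartier modules over `R`: pairs `(M, κ)` of an `R`-module `M` and an `R`-linear
map `κ : M ⟶ F^♭ M`, with the `R`-linear maps that commute with the structure maps. Such a `κ` is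
the adjoint of an `R`-linear map `F_* M ⟶ M`, that is, of a right action of `F` on `M` that makes
`M` a right module over the twisted polynomial ring `R[F]`. -/
abbrev CartierModule := Endofunctor.Coalgebra (frobeniusFlat R p)

/-- The category of unit Cartier modules over `R`: the full subcategory of the Cartier modules
`(M, κ)` whose structure map `κ : M ⟶ F^♭ M` is an isomorphism. -/
abbrev UnitCartierModule :=
  (Endofunctor.Coalgebra.isUnit (frobeniusFlat R p)).FullSubcategory

instance : (frobeniusFlat R p).Additive :=
  (ModuleCat.restrictCoextendScalarsAdj.{u, u, u} (frobenius R p)).right_adjoint_additive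

instance : PreservesFiniteLimits (frobeniusFlat R p) :=
  have := (ModuleCat.restrictCoextendScalarsAdj.{u, u, u}
    (frobenius R p)).rightAdjoint_preservesLimits
  inferInstance

instance [IsNoetherianRing R] [IsFFinite R p] :
    PreservesColimitsOfShape ℕ (frobeniusFlat R p) :=
  preservesColimitsOfShape_nat_coextendScalars (frobenius R p) IsFFinite.finite_frobenius

end CartierModules

/-! The inclusion `i` of unit Cartier modules has a left adjoint `L`, the unitalization colim (M →
F^♭M → F^♭F^♭M → ...). Suppose that `L` and `i` are both exact. They then act termwise on complexes
and on derived categories, and since `i` is fully faithful, `L i ≅ id`. Hence both maps Ext(X, Y) →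
Ext(iX, iY) and Ext(X, iY) → Ext(LX, LiY) = Ext(LX, Y) are injective: a class is a fraction, and a
numerator that dies after applying one functor is recovered by applying the other. Vanishing of Ext
into M therefore passes in both directions, without any injective resolution
(`Adjunction.injectiveDimension_eq_of_reflective`).

Three of the four exactness statements are formal: `L` is right exact and `i` left exact by
adjunction, and `L` is left exact because F^♭ and sequential colimits are. Right exactness of `i`
follows from that of F^♭ = Hom(F_*R, -), so F_*R must be projective. This is the finite case of
Kunz's theorem (`IsRegularRing.projective_of_algebraMap_eq_pow`). After localization, the maximal
ideal is generated by a regular sequence; its p-th powers are again regular on R, so the sequence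
itself is regular on F_*R, which forces the finite module F_*R to be free. -/

namespace CategoryTheory

universe v₁ v₂ u₁ u₂ w₁ w₂

open _root_.DerivedCategory

variable {C : Type u₁} [Category.{v₁} C] [Abelian C] {D : Type u₂} [Category.{v₂} D] [Abelian D]

/-! ### Exact functors and extension classes as fractions -/

section

variable [HasDerivedCategory.{w₁} C] [HasDerivedCategory.{w₂} D]
  (F : C ⥤ D) [F.Additive] [PreservesFiniteLimits F] [PreservesFiniteColimits F]

lemma Functor.mapDerivedCategory_map_Q_map_eq_zero_iff {A B : CochainComplex C ℤ} (g : A ⟶ B) :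
    F.mapDerivedCategory.map (Q.map g) = 0 ↔
      Q.map ((F.mapHomologicalComplex (ComplexShape.up ℤ)).map g) = 0 := by
  have h := F.mapDerivedCategoryFactors_hom_naturality g
  constructor
  · intro h0
    rw [h0, Limits.zero_comp] at h
    rw [← cancel_epi (F.mapDerivedCategoryFactors.hom.app A), ← h, Limits.comp_zero]
  · intro h0
    rw [h0, Limits.comp_zero] at h
    rwa [← cancel_mono (F.mapDerivedCategoryFactors.hom.app B), Limits.zero_comp]

/-- A morphism in the derived category that is killed by an exact functor is represented
by a fraction whose numerator is killed by this functor. -/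
lemma _root_.DerivedCategory.exists_right_fac_of_map_eq_zero {A B : CochainComplex C ℤ}
    {f : Q.obj A ⟶ Q.obj B} (hf : F.mapDerivedCategory.map f = 0) :
    ∃ (A' : CochainComplex C ℤ) (s : A' ⟶ A) (_ : IsIso (Q.map s)) (g : A' ⟶ B),
      f = inv (Q.map s) ≫ Q.map g ∧
        Q.map ((F.mapHomologicalComplex (ComplexShape.up ℤ)).map g) = 0 := by
  obtain ⟨A', s, hs, g, rfl⟩ := right_fac f
  refine ⟨A', s, hs, g, rfl, (F.mapDerivedCategory_map_Q_map_eq_zero_iff g).1 ?_⟩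
  rw [Functor.map_comp] at hf
  rw [← cancel_epi (F.mapDerivedCategory.map (inv (Q.map s))), hf, Limits.comp_zero]

/-- The morphism between objects in the image of the localization functor that
corresponds to an extension class. -/
noncomputable def Abelian.Ext.homQ [HasExt.{w₁} C] {X Y : C} {n : ℕ} (e : Abelian.Ext.{w₁} X Y n) :
    Q.obj ((HomologicalComplex.single C (ComplexShape.up ℤ) 0).obj X) ⟶
      Q.obj ((HomologicalComplex.single C (ComplexShape.up ℤ) (-n)).obj Y) :=
  e.hom ≫ ((singleFunctors C).shiftIso (n : ℤ) (-n) 0 (by simp)).hom.app Y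

/-- `homQ` differs from `hom` by a shift isomorphism, so nothing is lost. It is introduced because
the calculus of fractions needs source and target of the form `Q.obj _`. -/
lemma Abelian.Ext.eq_zero_of_homQ [HasExt.{w₁} C] {X Y : C} {n : ℕ} (e : Abelian.Ext.{w₁} X Y n)
    (h : e.homQ = 0) : e = 0 := by
  have h' : e.hom ≫ ((singleFunctors C).shiftIso (n : ℤ) (-n) 0 (by simp)).hom.app Y = 0 := h
  ext
  rw [zero_hom]
  exact (cancel_mono _).1 (h'.trans Limits.zero_comp.symm)

lemma Abelian.Ext.map_homQ_eq_zero [HasExt.{w₁} C] [HasExt.{w₂} D] {X Y : C} {n : ℕ}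
    (e : Abelian.Ext.{w₁} X Y n) (h : e.mapExactFunctor F = (0 : Abelian.Ext.{w₂} _ _ n)) :
    F.mapDerivedCategory.map e.homQ = 0 := by
  have h1 : (e.mapExactFunctor F : Abelian.Ext.{w₂} _ _ n).hom = 0 := by rw [h, zero_hom]
  rw [mapExactFunctor_hom, ShiftedHom.map] at h1
  have h2 : F.mapDerivedCategory.map e.hom = 0 := by
    -- The image class is `F.mapDerivedCategory.map e.hom` framed by the isomorphisms comparing `F`
    -- with shifts and single functors; these are cancelled.
    rw [← cancel_mono ((F.mapDerivedCategory.commShiftIso (n : ℤ)).hom.app _), Limits.zero_comp,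
      ← cancel_mono (((F.mapDerivedCategorySingleFunctor 0).hom.app Y)⟦(n : ℤ)⟧'), Limits.zero_comp,
      ← cancel_epi ((F.mapDerivedCategorySingleFunctor 0).inv.app X), Limits.comp_zero]
    exact h1
  exact (F.mapDerivedCategory.map_comp _ _).trans
    ((congrArg (fun t => t ≫ _) h2).trans Limits.zero_comp)

end

/-! ### Reflective subcategories with exact inclusion and exact reflector -/

section Adjunction

variable {L : D ⥤ C} {i : C ⥤ D} [L.Additive] [i.Additive]

section

variable [HasDerivedCategory.{w₁} C] [HasDerivedCategory.{w₂} D]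

/-- The counit is an isomorphism in each degree, so `g` is isomorphic to `L (i g)`, and the exact
functor `L` preserves being zero in the derived category. -/
lemma Adjunction.Q_map_eq_zero_of_reflective (adj : L ⊣ i) [i.Full] [i.Faithful]
    [PreservesFiniteLimits L] [PreservesFiniteColimits L] {A B : CochainComplex C ℤ} {g : A ⟶ B}
    (hg : Q.map ((i.mapHomologicalComplex (ComplexShape.up ℤ)).map g) = 0) : Q.map g = 0 := by
  have h1 : Q.map ((L.mapHomologicalComplex (ComplexShape.up ℤ)).map
      ((i.mapHomologicalComplex (ComplexShape.up ℤ)).map g)) = 0 := by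
    rw [← L.mapDerivedCategory_map_Q_map_eq_zero_iff, hg, Functor.map_zero]
  let ε (K : CochainComplex C ℤ) : (L.mapHomologicalComplex (ComplexShape.up ℤ)).obj
      ((i.mapHomologicalComplex (ComplexShape.up ℤ)).obj K) ⟶ K :=
    { f := fun j => adj.counit.app (K.X j)
      comm' := fun j k _ => (adj.counit.naturality (K.d j k)).symm }
  have (K : CochainComplex C ℤ) : IsIso (ε K) :=
    have (j : ℤ) : IsIso ((ε K).f j) := inferInstanceAs (IsIso (adj.counit.app (K.X j)))
    HomologicalComplex.Hom.isIso_of_components _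
  have h2 : (L.mapHomologicalComplex (ComplexShape.up ℤ)).map
      ((i.mapHomologicalComplex (ComplexShape.up ℤ)).map g) ≫ ε B = ε A ≫ g := by
    ext j
    exact adj.counit.naturality (g.f j)
  rw [← cancel_epi (Q.map (ε A)), ← Q.map_comp, ← h2, Q.map_comp, h1, Limits.zero_comp, Limits.comp_zero]

/-- Naturality gives `g ≫ η B = η A ≫ i (L g)`, so only `η B` has to be cancelled. Nothing is asked
of `A`, which will be the uncontrolled middle object of a fraction. -/
lemma Adjunction.Q_map_eq_zero_of_isIso_unit (adj : L ⊣ i)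
    [PreservesFiniteLimits i] [PreservesFiniteColimits i] {A B : CochainComplex D ℤ} {g : A ⟶ B}
    (hB : ∀ j, IsIso (adj.unit.app (B.X j)))
    (hg : Q.map ((L.mapHomologicalComplex (ComplexShape.up ℤ)).map g) = 0) : Q.map g = 0 := by
  have h1 : Q.map ((i.mapHomologicalComplex (ComplexShape.up ℤ)).map
      ((L.mapHomologicalComplex (ComplexShape.up ℤ)).map g)) = 0 := by
    rw [← i.mapDerivedCategory_map_Q_map_eq_zero_iff, hg, Functor.map_zero]
  let η (K : CochainComplex D ℤ) : K ⟶ (i.mapHomologicalComplex (ComplexShape.up ℤ)).obj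
      ((L.mapHomologicalComplex (ComplexShape.up ℤ)).obj K) :=
    { f := fun j => adj.unit.app (K.X j)
      comm' := fun j k _ => (adj.unit.naturality (K.d j k)).symm }
  have : IsIso (η B) :=
    have (j : ℤ) : IsIso ((η B).f j) := hB j
    HomologicalComplex.Hom.isIso_of_components _
  have h2 : g ≫ η B = η A ≫ (i.mapHomologicalComplex (ComplexShape.up ℤ)).map
      ((L.mapHomologicalComplex (ComplexShape.up ℤ)).map g) := by
    ext j
    exact adj.unit.naturality (g.f j)
  rw [← cancel_mono (Q.map (η B)), ← Q.map_comp, h2, Q.map_comp, h1, Limits.zero_comp, Limits.comp_zero]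

lemma Adjunction.ext_eq_zero_of_mapExactFunctor_rightAdjoint (adj : L ⊣ i) [i.Full] [i.Faithful]
    [PreservesFiniteLimits L] [PreservesFiniteColimits L]
    [PreservesFiniteLimits i] [PreservesFiniteColimits i] [HasExt.{w₁} C] [HasExt.{w₂} D]
    {X Y : C} {n : ℕ} (e : Abelian.Ext.{w₁} X Y n)
    (h : e.mapExactFunctor i = (0 : Abelian.Ext.{w₂} _ _ n)) : e = 0 := by
  obtain ⟨A', s, hs, g, h1, h2⟩ := exists_right_fac_of_map_eq_zero i (e.map_homQ_eq_zero i h)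
  exact e.eq_zero_of_homQ (by rw [h1, adj.Q_map_eq_zero_of_reflective h2, Limits.comp_zero])

/-- The first argument need not lie in the subcategory: only the target of the numerator must have
invertible unit. -/
lemma Adjunction.ext_eq_zero_of_mapExactFunctor_leftAdjoint (adj : L ⊣ i) [i.Full] [i.Faithful]
    [PreservesFiniteLimits L] [PreservesFiniteColimits L]
    [PreservesFiniteLimits i] [PreservesFiniteColimits i] [HasExt.{w₁} C] [HasExt.{w₂} D]
    {X : D} {Y : C} {n : ℕ} (e : Abelian.Ext.{w₂} X (i.obj Y) n)
    (h : e.mapExactFunctor L = (0 : Abelian.Ext.{w₁} _ _ n)) : e = 0 := by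
  obtain ⟨A', s, hs, g, h1, h2⟩ := exists_right_fac_of_map_eq_zero L (e.map_homQ_eq_zero L h)
  -- The target complex is `i.obj Y` in degree `-n`, where the unit is invertible because `i` is
  -- fully faithful, and zero elsewhere.
  have hB (j : ℤ) : IsIso (adj.unit.app
      (((HomologicalComplex.single D (ComplexShape.up ℤ) (-(n : ℤ))).obj (i.obj Y)).X j)) := by
    by_cases hj : j = -(n : ℤ)
    · have : IsIso (adj.unit.app (i.obj Y)) := inferInstance
      subst hj
      exact (NatTrans.isIso_app_iff_of_iso adj.unit
        (HomologicalComplex.singleObjXSelf (ComplexShape.up ℤ) (-(n : ℤ)) (i.obj Y))).2 this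
    · have h0 := HomologicalComplex.isZero_single_obj_X (ComplexShape.up ℤ) _ (i.obj Y) _ hj
      exact ⟨0, h0.eq_of_src _ _, ((L ⋙ i).map_isZero h0).eq_of_src _ _⟩
  exact e.eq_zero_of_homQ (by rw [h1, adj.Q_map_eq_zero_of_isIso_unit hB h2, Limits.comp_zero])

end

lemma Adjunction.hasInjectiveDimensionLT_iff_of_reflective (adj : L ⊣ i) [i.Full] [i.Faithful]
    [PreservesFiniteLimits L] [PreservesFiniteColimits L]
    [PreservesFiniteLimits i] [PreservesFiniteColimits i] (M : C) (n : ℕ) :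
    HasInjectiveDimensionLT M n ↔ HasInjectiveDimensionLT (i.obj M) n := by
  let := HasDerivedCategory.standard C
  let := HasDerivedCategory.standard D
  let := HasExt.standard C
  let := HasExt.standard D
  constructor
  · intro _
    refine HasInjectiveDimensionLT.mk fun k hk Y e =>
      adj.ext_eq_zero_of_mapExactFunctor_leftAdjoint e ?_
    have : HasInjectiveDimensionLT (L.obj (i.obj M)) n :=
      hasInjectiveDimensionLT_of_iso
        (show M ≅ L.obj (i.obj M) from (asIso (adj.counit.app M)).symm) n
    exact Abelian.Ext.eq_zero_of_hasInjectiveDimensionLT _ n hk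
  · intro _
    exact HasInjectiveDimensionLT.mk fun k hk Y e =>
      adj.ext_eq_zero_of_mapExactFunctor_rightAdjoint e
        (Abelian.Ext.eq_zero_of_hasInjectiveDimensionLT _ n hk)

/-- The inclusion of an exact reflective subcategory with exact reflector preserves
injective dimensions. -/
theorem Adjunction.injectiveDimension_eq_of_reflective (adj : L ⊣ i) [i.Full] [i.Faithful]
    [PreservesFiniteLimits L] [PreservesFiniteColimits L]
    [PreservesFiniteLimits i] [PreservesFiniteColimits i] (M : C) :
    injectiveDimension M = injectiveDimension (i.obj M) := by
  simp only [injectiveDimension, adj.hasInjectiveDimensionLT_iff_of_reflective M]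

end Adjunction

end CategoryTheory

/-! ### Exactness of the inclusion of unit coalgebras -/

namespace CategoryTheory.Endofunctor.Coalgebra

variable {C : Type u} [Category.{v} C] (G : C ⥤ C)

section

variable (J : Type) [SmallCategory J] [HasColimitsOfShape J C] [PreservesColimitsOfShape J G]

instance : PreservesColimitsOfShape J (lift G) :=
  have : PreservesColimitsOfShape J (lift G ⋙ forget G) :=
    inferInstanceAs (PreservesColimitsOfShape J (forget G ⋙ G))
  preservesColimitsOfShape_of_reflects_of_preserves (lift G) (forget G)

/-- Since `lift G` preserves the colimit, the structure morphism of the colimit is the map induced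
by those of the diagram, which are isomorphisms. -/
instance isClosedUnderColimitsOfShape_isUnit : (isUnit G).IsClosedUnderColimitsOfShape J where
  colimitsOfShape_le := by
    rintro X ⟨p⟩
    have hX := isColimitOfPreserves (lift G) p.isColimit
    have (j : J) : IsIso ((toLift G).app (p.diag.obj j)) := isIso_toLift_app (p.prop_diag_obj j)
    have : IsIso (Functor.whiskerLeft p.diag (toLift G)) := by
      have (j : J) : IsIso ((Functor.whiskerLeft p.diag (toLift G)).app j) := this j
      exact NatIso.isIso_of_isIso_app _
    let e : p.diag ≅ p.diag ⋙ lift G := asIso (Functor.whiskerLeft p.diag (toLift G))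
    have h : (toLift G).app X = (p.isColimit.coconePointsIsoOfNatIso hX e).hom := by
      refine p.isColimit.hom_ext fun j => ?_
      rw [IsColimit.comp_coconePointsIsoOfNatIso_hom]
      exact (toLift G).naturality (p.ι.app j)
    have : IsIso ((toLift G).app X) := by rw [h]; infer_instance
    exact inferInstanceAs (IsIso ((forget G).map ((toLift G).app X)))

end

variable [HasFiniteColimits C] [PreservesFiniteColimits G]

instance : PreservesFiniteColimits (isUnit G).ι where
  preservesFiniteColimits J _ _ :=
    have : HasColimitsOfShape J (Coalgebra G) :=
      hasColimitsOfShape_of_hasColimitsOfShape_createsColimitsOfShape (forget G)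
    inferInstance

end CategoryTheory.Endofunctor.Coalgebra

open CategoryTheory.Endofunctor.Coalgebra in
/-- If `G` is exact and commutes with sequential colimits, then the inclusion of the unit
coalgebras into all coalgebras preserves injective dimensions. -/
theorem CategoryTheory.Endofunctor.Coalgebra.injectiveDimension_eq
    {C : Type u} [Category.{v} C] (G : C ⥤ C) [Abelian C] [G.Additive] [PreservesFiniteLimits G]
    [PreservesFiniteColimits G] [HasColimitsOfShape ℕ C] [PreservesColimitsOfShape ℕ G]
    [HasExactColimitsOfShape ℕ C] (M : (isUnit G).FullSubcategory) :
    injectiveDimension M = injectiveDimension M.obj := by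
  -- The adjunction supplies one half of the exactness of each functor. The other halves come from
  -- exact sequential colimits (for `toUnit G`) and closure under finite colimits (for the
  -- inclusion).
  have := (toUnitAdj G).leftAdjoint_preservesColimits
  have := (toUnitAdj G).rightAdjoint_preservesLimits
  have : (toUnit G).Additive := Functor.additive_of_preserves_binary_products _
  have : (isUnit G).ι.Additive := Functor.additive_of_preserves_binary_products _
  exact (toUnitAdj G).injectiveDimension_eq_of_reflective M

/-! ### Exactness of coextension of scalars -/

/-- Coextension of scalars along `f : R →+* S` is exact if `S` is a projective `R`-module. -/
lemma ModuleCat.preservesFiniteColimits_coextendScalars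
    {R S : Type u} [CommRing R] [CommRing S] (f : R →+* S)
    [Module.Projective R ((ModuleCat.restrictScalars f).obj (ModuleCat.of S S))] :
    PreservesFiniteColimits (ModuleCat.coextendScalars.{u, u, u} f) := by
  have := (ModuleCat.restrictCoextendScalarsAdj.{u, u, u} f).right_adjoint_additive
  have := (ModuleCat.restrictCoextendScalarsAdj.{u, u, u} f).rightAdjoint_preservesLimits
  rw [Functor.preservesFiniteColimits_iff_forall_exact_map_and_epi]
  -- From here `S` is a short exact sequence, no longer the ring. A right adjoint is left exact, so
  -- only surjectivity remains, which is lifting of linear maps out of a projective module.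
  refine fun S hS => ⟨((Functor.preservesFiniteLimits_iff_forall_exact_map_and_mono
    (ModuleCat.coextendScalars.{u, u, u} f)).1 inferInstance S hS).1, ?_⟩
  have := hS.epi_g
  rw [ModuleCat.epi_iff_surjective] at this ⊢
  intro φ
  obtain ⟨ψ, hψ⟩ := Module.projective_lifting_property S.g.hom
    (ModuleCat.CoextendScalars.equiv f S.X₃ φ) this
  exact ⟨(ModuleCat.CoextendScalars.equiv f S.X₂).symm ψ, hψ⟩

/-! ### Regular local rings and their regular sequences -/

namespace IsLocalRing

variable {R : Type*} [CommRing R] [IsLocalRing R]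

lemma isLocalRing_quotient_span_singleton {x : R} (hx : x ∈ maximalIdeal R) :
    IsLocalRing (R ⧸ Ideal.span {x}) :=
  have : Nontrivial (R ⧸ Ideal.span {x}) := Ideal.Quotient.nontrivial_iff.2 fun h =>
    (maximalIdeal.isMaximal R).ne_top (top_le_iff.1 (h ▸ (Ideal.span_singleton_le_iff_mem _).2 hx))
  .of_surjective' _ Ideal.Quotient.mk_surjective

lemma comap_maximalIdeal_quotient (I : Ideal R) [IsLocalRing (R ⧸ I)] :
    (maximalIdeal (R ⧸ I)).comap (Ideal.Quotient.mk I) = maximalIdeal R :=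
  eq_maximalIdeal (Ideal.comap_isMaximal_of_surjective _ Ideal.Quotient.mk_surjective)

lemma map_maximalIdeal_quotient (I : Ideal R) [IsLocalRing (R ⧸ I)] :
    (maximalIdeal R).map (Ideal.Quotient.mk I) = maximalIdeal (R ⧸ I) := by
  rw [← comap_maximalIdeal_quotient I,
    Ideal.map_comap_of_surjective _ Ideal.Quotient.mk_surjective]

/-- Write `x` in a minimal generating set. As `x` is not in the square of the maximal ideal, some
coefficient is a unit, so `x` can replace that generator, and the others generate modulo `x`. -/
lemma spanFinrank_maximalIdeal_quotient_lt [IsNoetherianRing R] {x : R} (hx : x ∈ maximalIdeal R)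
    (hx2 : x ∉ maximalIdeal R ^ 2) [IsLocalRing (R ⧸ Ideal.span {x})] :
    (maximalIdeal (R ⧸ Ideal.span {x})).spanFinrank + 1 ≤ (maximalIdeal R).spanFinrank := by
  classical
  obtain ⟨s, hs, hspan⟩ := Submodule.FG.exists_span_finset_card_eq_spanFinrank
    (maximalIdeal R).fg_of_isNoetherianRing
  have hsm (a : R) (ha : a ∈ s) : a ∈ maximalIdeal R := hspan ▸ Submodule.subset_span ha
  rw [← hspan] at hx
  obtain ⟨f, -, hf⟩ := Submodule.mem_span_finset.1 hx
  obtain ⟨a, ha, hu⟩ : ∃ a ∈ s, IsUnit (f a) := by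
    by_contra! h
    refine hx2 (hf ▸ Ideal.sum_mem _ fun a ha => ?_)
    rw [pow_two]
    exact Ideal.mul_mem_mul (h a ha) (hsm a ha)
  have hle : maximalIdeal R ≤ Ideal.span {x} ⊔ Ideal.span (s.erase a : Set R) := by
    rw [← hspan, Submodule.span_le]
    intro b hb
    by_cases hba : b = a
    · subst hba
      rw [SetLike.mem_coe, ← Ideal.unit_mul_mem_iff_mem _ hu]
      have h : f b * b = x - ∑ c ∈ s.erase b, f c * c := by
        rw [← hf, ← Finset.add_sum_erase s _ ha]
        simp
      rw [h]
      exact sub_mem (Ideal.mem_sup_left (Ideal.mem_span_singleton_self x))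
        (Ideal.mem_sup_right (Ideal.sum_mem _ fun c hc =>
          Ideal.mul_mem_left _ _ (Ideal.subset_span hc)))
    · exact Ideal.mem_sup_right (Ideal.subset_span (Finset.mem_coe.2 (Finset.mem_erase.2 ⟨hba, hb⟩)))
  have heq : maximalIdeal (R ⧸ Ideal.span {x}) =
      Ideal.span (Ideal.Quotient.mk (Ideal.span {x}) '' (s.erase a : Set R)) := by
    refine le_antisymm ?_ ?_
    · rw [← map_maximalIdeal_quotient, ← Ideal.map_span]
      refine (Ideal.map_mono hle).trans ?_
      rw [Ideal.map_sup, Ideal.map_quotient_self, bot_sup_eq]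
    · rw [← map_maximalIdeal_quotient, ← Ideal.map_span]
      exact Ideal.map_mono (Ideal.span_le.2 fun b hb => hsm b (Finset.mem_of_mem_erase hb))
  have h1 : (maximalIdeal (R ⧸ Ideal.span {x})).spanFinrank ≤ (s.erase a).card := by
    rw [heq]
    refine (Submodule.spanFinrank_span_le_ncard_of_finite ((s.erase a).finite_toSet.image _)).trans ?_
    exact (Set.ncard_image_le (s.erase a).finite_toSet).trans (Set.ncard_coe_finset _).le
  have h2 := Finset.card_erase_add_one ha
  lia

end IsLocalRing

open IsLocalRing RingTheory.Sequence

lemma ringKrullDim_le_ringKrullDim_quotient_span_singleton_add_one {R : Type*} [CommRing R]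
    [IsLocalRing R] [IsNoetherianRing R] {x : R} (hx : x ∈ maximalIdeal R) :
    ringKrullDim R ≤ ringKrullDim (R ⧸ Ideal.span {x}) + 1 := by
  have hs : ({x} : Set R) ⊆ (Ring.jacobson R : Ideal R) := by
    simpa [ringJacobson_eq_maximalIdeal] using hx
  simpa using ringKrullDim_le_ringKrullDim_quotient_add_encard _ hs

namespace IsRegularLocalRing

/-- Modulo `x` the number of generators drops by at least one and the dimension by at most one, so
the former is still bounded by the latter. -/
lemma quotient_span_singleton {R : Type*} [CommRing R] [IsRegularLocalRing R] {x : R}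
    (hx : x ∈ maximalIdeal R) (hx2 : x ∉ maximalIdeal R ^ 2) :
    IsRegularLocalRing (R ⧸ Ideal.span {x}) := by
  have := isLocalRing_quotient_span_singleton hx
  have h := spanFinrank_maximalIdeal_quotient_lt hx hx2
  apply IsRegularLocalRing.of_spanFinrank_maximalIdeal_le
  have h1 : ringKrullDim R ≤ ringKrullDim (R ⧸ Ideal.span {x}) + 1 :=
    ringKrullDim_le_ringKrullDim_quotient_span_singleton_add_one hx
  rw [← (isRegularLocalRing_iff R).1 inferInstance] at h1
  have h2 : (((maximalIdeal (R ⧸ Ideal.span {x})).spanFinrank : WithBot ℕ∞)) + 1 ≤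
      ringKrullDim (R ⧸ Ideal.span {x}) + 1 := le_trans (by exact_mod_cast h) h1
  exact ENat.WithBot.add_le_add_one_right_iff.1 h2

/-- If the maximal ideal of a regular local ring is nonzero, it contains an element outside
of its square and of all minimal primes. -/
lemma exists_mem_maximalIdeal {R : Type*} [CommRing R] [IsRegularLocalRing R]
    (h : maximalIdeal R ≠ ⊥) :
    ∃ x ∈ maximalIdeal R, x ∉ maximalIdeal R ^ 2 ∧ ∀ q ∈ minimalPrimes R, x ∉ q := by
  by_contra! H
  have hfin : (insert (maximalIdeal R ^ 2) (minimalPrimes R)).Finite :=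
    (minimalPrimes.finite_of_isNoetherianRing R).insert _
  -- Prime avoidance tolerates two non-prime ideals; the square of the maximal ideal fills both
  -- slots.
  obtain ⟨I, hI, hle⟩ := (Ideal.subset_union_prime_finite hfin (f := id) (I := maximalIdeal R)
    (maximalIdeal R ^ 2) (maximalIdeal R ^ 2) fun I hI hne _ =>
      (hI.resolve_left hne).isPrime).1 fun x hx => by
    by_cases hx2 : x ∈ maximalIdeal R ^ 2
    · exact Set.mem_biUnion (Set.mem_insert _ _) hx2
    · obtain ⟨q, hq, hxq⟩ := H x hx hx2
      exact Set.mem_biUnion (Set.mem_insert_of_mem _ hq) hxq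
  obtain rfl | hI := hI
  · refine h (Submodule.eq_bot_of_le_smul_of_le_jacobson_bot _ _
      (maximalIdeal R).fg_of_isNoetherianRing ?_ (maximalIdeal_le_jacobson _))
    rw [smul_eq_mul, ← pow_two]
    exact hle
  -- Now the maximal ideal is a minimal prime, so the dimension, hence the number of generators, is
  -- zero.
  · have := hI.isPrime
    have hIm : I = maximalIdeal R := le_antisymm (le_maximalIdeal this.ne_top) hle
    subst hIm
    have h0 := maximalIdeal_height_eq_ringKrullDim (R := R)
    rw [Ideal.height_eq_zero_iff.2 hI, ← (isRegularLocalRing_iff R).1 inferInstance] at h0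
    have h0 : 0 = (maximalIdeal R).spanFinrank := by exact_mod_cast h0
    exact h ((Submodule.spanFinrank_eq_zero_iff_eq_bot
      (maximalIdeal R).fg_of_isNoetherianRing).1 h0.symm)

/-- A regular local ring is a domain whose maximal ideal is generated by a regular sequence. -/
theorem isDomain_and_exists_isWeaklyRegular (R : Type u) [CommRing R] [IsRegularLocalRing R] :
    IsDomain R ∧ ∃ rs : List R, IsWeaklyRegular R rs ∧ Ideal.ofList rs = maximalIdeal R := by
  by_cases h : maximalIdeal R = ⊥
  · refine ⟨(isField_iff_maximalIdeal_eq.2 h).isDomain, [], .nil R R, ?_⟩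
    rw [Ideal.ofList_nil, h]
  obtain ⟨x, hx, hx2, hxq⟩ := exists_mem_maximalIdeal h
  have := quotient_span_singleton hx hx2
  -- This is the decrease that makes the recursive call terminate.
  have hlt := spanFinrank_maximalIdeal_quotient_lt hx hx2
  obtain ⟨hdom, rs, hrs, hm⟩ := isDomain_and_exists_isWeaklyRegular (R ⧸ Ideal.span {x})
  have hprime : (Ideal.span {x}).IsPrime := (Ideal.Quotient.isDomain_iff_prime _).1 hdom
  obtain ⟨q, hq, hle⟩ := Ideal.exists_minimalPrimes_le (bot_le (a := Ideal.span {x}))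
  have hqp : q.IsPrime := hq.isPrime
  -- The minimal prime `q` lies in the prime `(x)` but does not contain `x`, so `q = x q`, and
  -- Nakayama gives `q = 0`.
  have hq0 : q = ⊥ := by
    refine Submodule.eq_bot_of_le_smul_of_le_jacobson_bot (Ideal.span {x}) q
      q.fg_of_isNoetherianRing (fun y hy => ?_)
      (((Ideal.span_singleton_le_iff_mem _).2 hx).trans (maximalIdeal_le_jacobson _))
    obtain ⟨z, rfl⟩ := Ideal.mem_span_singleton'.1 (hle hy)
    rw [smul_eq_mul, mul_comm z x]
    exact Ideal.mul_mem_mul (Ideal.mem_span_singleton_self x)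
      ((hqp.mem_or_mem hy).resolve_right (hxq q hq))
  subst hq0
  have hR : IsDomain R := (IsDomain.of_bot_isPrime R)
  have hx0 : x ≠ 0 := fun h0 => hx2 (h0 ▸ zero_mem _)
  refine ⟨hR, ?_⟩
  obtain ⟨rs, rfl⟩ := List.map_surjective_iff.2
    (Ideal.Quotient.mk_surjective (I := Ideal.span {x})) rs
  refine ⟨x :: rs, .cons (fun a b hab => mul_left_cancel₀ hx0 hab) ?_, ?_⟩
  · have e : QuotSMulTop x R ≃ₗ[R] R ⧸ Ideal.span {x} :=
      Submodule.quotEquivOfEq _ _ (by rw [← Submodule.ideal_span_singleton_smul]; simp)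
    rw [e.isWeaklyRegular_congr]
    exact (isWeaklyRegular_map_algebraMap_iff (R ⧸ Ideal.span {x}) _ rs).1 hrs
  · rw [← Ideal.map_ofList] at hm
    have h := Ideal.comap_map_of_surjective' (Ideal.Quotient.mk (Ideal.span {x}))
      Ideal.Quotient.mk_surjective (Ideal.ofList rs)
    rw [hm, comap_maximalIdeal_quotient, Ideal.mk_ker] at h
    rw [Ideal.ofList_cons, sup_comm, h]
termination_by (maximalIdeal R).spanFinrank

end IsRegularLocalRing

/-! ### Kunz's theorem for finite power maps -/

open IsLocalRing RingTheory.Sequence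

/-- Regular sequences in the maximal ideal may be permuted on a finite module over a noetherian
local ring. So `r` is moved to the end, where raising it to a power only concerns a single regular
element, and then moved back. -/
lemma IsLocalRing.isWeaklyRegular_map_pow {R : Type*} [CommRing R] [IsLocalRing R]
    [IsNoetherianRing R] {n : ℕ} (hn : n ≠ 0) {M : Type*} [AddCommGroup M] [Module R M]
    [Module.Finite R M] {rs : List R} (h : IsWeaklyRegular M rs)
    (hrs : ∀ r ∈ rs, r ∈ maximalIdeal R) : IsWeaklyRegular M (rs.map (· ^ n)) := by
  induction rs generalizing M with
  | nil => exact .nil R M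
  | cons r rs ih =>
    have hr : r ∈ maximalIdeal R := hrs r (by simp)
    have hpow : ∀ a ∈ rs.map (· ^ n), a ∈ maximalIdeal R := by
      intro a ha
      obtain ⟨b, hb, rfl⟩ := List.mem_map.1 ha
      exact Ideal.pow_mem_of_mem _ (hrs b (List.mem_cons_of_mem _ hb)) _ (Nat.pos_of_ne_zero hn)
    rw [isWeaklyRegular_cons_iff] at h
    have h1 : IsWeaklyRegular M (r :: rs.map (· ^ n)) :=
      .cons h.1 (ih h.2 fun a ha => hrs a (List.mem_cons_of_mem _ ha))
    have h2 := isWeaklyRegular_of_perm_of_subset_maximalIdeal h1 (List.perm_append_singleton r _).symm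
      (List.forall_mem_cons.2 ⟨hr, hpow⟩)
    rw [isWeaklyRegular_append_iff, isWeaklyRegular_singleton_iff] at h2
    have h3 : IsWeaklyRegular M (rs.map (· ^ n) ++ [r ^ n]) := by
      rw [isWeaklyRegular_append_iff, isWeaklyRegular_singleton_iff]
      exact ⟨h2.1, h2.2.pow n⟩
    refine isWeaklyRegular_of_perm_of_subset_maximalIdeal h3 (List.perm_append_singleton _ _) ?_
    intro a ha
    rcases List.mem_append.1 ha with ha | ha
    · exact hpow a ha
    · rw [List.mem_singleton.1 ha]
      exact Ideal.pow_mem_of_mem _ hr _ (Nat.pos_of_ne_zero hn)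

/-- A finite module over a noetherian local ring is free if the maximal ideal is generated by
a sequence that is regular on the module. -/
theorem IsLocalRing.free_of_isWeaklyRegular {R : Type*} [CommRing R] [IsLocalRing R]
    [IsNoetherianRing R] {M : Type*} [AddCommGroup M] [Module R M] [Module.Finite R M]
    (rs : List R) (h : IsWeaklyRegular M rs) (hrs : Ideal.ofList rs = maximalIdeal R) :
    Module.Free R M := by
  induction hd : rs.length generalizing R M with
  | zero =>
    obtain rfl := List.length_eq_zero_iff.1 hd
    rw [Ideal.ofList_nil] at hrs
    let := (isField_iff_maximalIdeal_eq.2 hrs.symm).toField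
    exact Module.Free.of_divisionRing R M
  | succ d ih =>
    obtain ⟨r, rs, rfl⟩ := List.exists_cons_of_length_eq_add_one hd
    have hr : r ∈ maximalIdeal R := hrs ▸ Ideal.subset_span (by simp)
    have := isLocalRing_quotient_span_singleton hr
    rw [isWeaklyRegular_cons_iff'] at h
    have := Module.Finite.of_restrictScalars_finite R (R ⧸ Ideal.span {r}) (QuotSMulTop r M)
    have := Module.finitePresentation_of_finite R M
    -- As `r` is regular on `M` and lies in the Jacobson radical, freeness lifts from `M/rM` over
    -- `R/(r)`, where the sequence is shorter.
    refine (Module.free_quotSMulTop_iff_free R M (maximalIdeal_le_jacobson _ hr) h.1).1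
      (ih _ h.2 ?_ (by simpa using hd))
    rw [← map_maximalIdeal_quotient, ← hrs, ← Ideal.map_ofList, Ideal.ofList_cons, Ideal.map_sup,
      Ideal.map_quotient_self, bot_sup_eq]

/-- The regular local case of the flatness of the Frobenius endomorphism: if a power map of a
regular local ring `R` is (up to an isomorphism `R ≃+* S`) a finite ring homomorphism `R → S`,
then `S` is a free `R`-module. -/
theorem IsRegularLocalRing.free_of_algebraMap_eq_pow {R : Type u} [CommRing R]
    [IsRegularLocalRing R] {S : Type*} [CommRing S] [Algebra R S] [Module.Finite R S]
    (e : R ≃+* S) {n : ℕ} (hn : n ≠ 0) (h : ∀ r, algebraMap R S r = e (r ^ n)) :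
    Module.Free R S := by
  obtain ⟨-, rs, hrs, hm⟩ := isDomain_and_exists_isWeaklyRegular R
  have h1 := isWeaklyRegular_map_pow hn hrs fun r hr => hm ▸ Ideal.subset_span hr
  refine free_of_isWeaklyRegular rs ?_ hm
  rw [← isWeaklyRegular_map_algebraMap_iff S S rs]
  -- Through `e`, multiplication by the image of `r` in `S` is multiplication by `r ^ n` on `R`.
  refine (e.toAddEquiv.isWeaklyRegular_congr ?_).1 h1
  rw [List.forall₂_map_left_iff, List.forall₂_map_right_iff, List.forall₂_same]
  intro r _ x
  rw [h]
  exact e.map_mul _ _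

/-- The finite case of Kunz's theorem: if a power map of a regular ring `R` is (up to an
isomorphism `R ≃+* S`) a finite ring homomorphism `R → S`, then `S` is a projective `R`-module. -/
theorem IsRegularRing.projective_of_algebraMap_eq_pow {R : Type u} [CommRing R]
    [IsRegularRing R] {S : Type u} [CommRing S] [Algebra R S] [Module.Finite R S]
    (e : R ≃+* S) {n : ℕ} (hn : n ≠ 0) (h : ∀ r, algebraMap R S r = e (r ^ n)) :
    Module.Projective R S := by
  have := Module.finitePresentation_of_finite R S
  have hloc (P : Ideal R) [P.IsMaximal] : IsLocalizedModule P.primeCompl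
      (IsScalarTower.toAlgHom R S
        (Localization (Algebra.algebraMapSubmonoid S P.primeCompl))).toLinearMap :=
    isLocalizedModule_iff_isLocalization.2 inferInstance
  refine Module.projective_of_localization_maximal' (fun P _ => Localization.AtPrime P)
    (fun P _ => Localization (Algebra.algebraMapSubmonoid S P.primeCompl))
    (fun P _ => (IsScalarTower.toAlgHom R S _).toLinearMap) fun P _ => ?_
  set Sₚ := Localization (Algebra.algebraMapSubmonoid S P.primeCompl)
  have : Module.Finite (Localization.AtPrime P) Sₚ :=
    Module.Finite.of_isLocalizedModule P.primeCompl (IsScalarTower.toAlgHom R S Sₚ).toLinearMap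
  -- `Sₚ` inverts only the elements `e (r ^ n)` with `r ∉ P`, but each `e r` divides `e (r ^ n)`.
  -- Hence `Sₚ` is also the transport along `e` of the localization of `R` at `P`.
  have : IsLocalization (P.primeCompl.map e) Sₚ := by
    refine IsLocalization.of_le_of_exists_dvd (Algebra.algebraMapSubmonoid S P.primeCompl) _ ?_ ?_
    · rintro _ ⟨r, hr, rfl⟩
      exact ⟨r ^ n, pow_mem hr n, (h r).symm⟩
    · rintro _ ⟨r, hr, rfl⟩
      refine ⟨algebraMap R S r, ⟨r, hr, rfl⟩, ?_⟩
      rw [h]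
      exact map_dvd e (dvd_pow_self r hn)
  let e' : Localization.AtPrime P ≃+* Sₚ :=
    IsLocalization.ringEquivOfRingEquiv (M := P.primeCompl) (T := P.primeCompl.map e) _ _ e rfl
  have he' (a : R) : e' (algebraMap R _ a ^ n) = algebraMap R Sₚ a := by
    have h1 : e' (algebraMap R _ (a ^ n)) = algebraMap S Sₚ (e (a ^ n)) :=
      IsLocalization.ringEquivOfRingEquiv_eq _ _
    rw [← map_pow, h1, ← h, ← IsScalarTower.algebraMap_apply]
  have : Module.Free (Localization.AtPrime P) Sₚ := by
    refine IsRegularLocalRing.free_of_algebraMap_eq_pow e' hn fun r => ?_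
    obtain ⟨a, s, rfl⟩ := IsLocalization.exists_mk'_eq P.primeCompl r
    have hs : IsUnit (algebraMap R Sₚ s) := by
      rw [IsScalarTower.algebraMap_apply R (Localization.AtPrime P) Sₚ]
      exact (IsLocalization.map_units _ s).map _
    -- The power formula is known on elements of `R`; multiplying by the denominator extends it to
    -- fractions.
    refine hs.mul_right_cancel ?_
    have hmk := IsLocalization.mk'_spec (Localization.AtPrime P) a s
    calc algebraMap _ Sₚ (IsLocalization.mk' _ a s) * algebraMap R Sₚ s
        = algebraMap R Sₚ a := by
          rw [IsScalarTower.algebraMap_apply R (Localization.AtPrime P) Sₚ, ← map_mul, hmk,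
            ← IsScalarTower.algebraMap_apply]
      _ = e' (IsLocalization.mk' _ a s ^ n) * algebraMap R Sₚ s := by
          rw [← he' a, ← he' s, ← map_mul, ← mul_pow, hmk]
  infer_instance

lemma IsRegularRing.projective_restrictScalars {R S : Type u} [CommRing R] [IsRegularRing R]
    [CommRing S] {f : R →+* S} (hf : f.Finite) (e : R ≃+* S) {n : ℕ} (hn : n ≠ 0)
    (h : ∀ r, f r = e (r ^ n)) :
    Module.Projective R ((ModuleCat.restrictScalars f).obj (ModuleCat.of S S)) := by
  algebraize [f]
  exact projective_of_algebraMap_eq_pow (S := S) e hn h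

/-- This is where regularity is used beyond the noetherian property: it makes F_*R projective.
Kunz's theorem is applied with `S` a second copy of `R`, the identity isomorphism and `n = p`. -/
lemma preservesFiniteColimits_frobeniusFlat (R : Type u) [CommRing R] (p : ℕ) [Fact p.Prime]
    [CharP R p] [IsRegularRing R] [IsFFinite R p] : PreservesFiniteColimits (frobeniusFlat R p) :=
  have := IsRegularRing.projective_restrictScalars (f := frobenius R p)
    IsFFinite.finite_frobenius (RingEquiv.refl R) (Fact.out : p.Prime).ne_zero fun _ => rfl
  ModuleCat.preservesFiniteColimits_coextendScalars _

theorem mainTheorem4 (R : Type u) [CommRing R] (p : ℕ) [Fact p.Prime] [CharP R p]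
    [IsRegularRing R] [IsFFinite R p] (M : UnitCartierModule R p) :
    injectiveDimension M = injectiveDimension (M.obj : CartierModule R p) :=
  have := preservesFiniteColimits_frobeniusFlat R p
  Endofunctor.Coalgebra.injectiveDimension_eq (frobeniusFlat R p) M
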